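/- Let $\mathbb{H}$ be the quaternions and let $X$ be a two-sided quaternionic Banach space, i.e. a Banach space with commuting left and right $\mathbb{H}$-vector space structures such that $\|qv\|=\|vq\|=|q|\,\|v\|$ for $q\in\mathbb{H}$, $v\in X$. Let $\mathcal{B}(X)$ be the algebra of bounded right $\mathbb{H}$-linear operators on $X$, with the operator norm and identity $\mathcal{I}$. For $T\in\mathcal{B}(X)$ the $S$-spectrum of $T$ is $$\sigma_S(T)=\{s\in\mathbb{H} : T^{2}-2\,\mathrm{Re}(s)\,T+|s|^{2}\mathcal{I}\ \text{is not invertible in}\ \mathcal{B}(X)\},$$ and its peripheral $S$-spectrum is $\Gamma_S(T)=\sigma_S(T)\cap\partial\mathbb{B}$, where $\mathbb{B}=\{q\in\mathbb{H}:|q|<1\}$. **Theorem.** Let $T\in\mathcal{B}(X)$ be power-bounded, i.e. $\sup_{n\in\mathbb{N}}\|T^{n}\|<\infty$. Then $$\lim_{n\to\infty}\|T^{n}-T^{n+1}\|=0\quad\Longleftrightarrow\quad \Gamma_S(T)\subseteq\{1\}.$$ -/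

import Mathlib

open scoped Quaternion

noncomputable section

namespace QuatOp

/- A two-sided quaternionic Banach space `X` is a complete normed group with a left `ℍ`-module
structure and a right `ℍ`-module structure (a module over `ℍᵐᵒᵖ`) that commute with each other,
`(q v) r = q (v r)`, with `‖q v‖ = |q| ‖v‖ = ‖v q‖`
(this is `NormSMulClass` for the two actions).
`X →L[ℍᵐᵒᵖ] X` is the ring of continuous (equivalently, bounded) right `ℍ`-linear operators. -/

/-- The operator norm, `‖T‖ = inf {c ≥ 0 : ‖T v‖ ≤ c ‖v‖ for all v}`. -/
def opNorm {X : Type*} [NormedAddCommGroup X] [Module ℍᵐᵒᵖ X] (T : X →L[ℍᵐᵒᵖ] X) : ℝ :=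
  sInf {c : ℝ | 0 ≤ c ∧ ∀ v : X, ‖T v‖ ≤ c * ‖v‖}

/-- `T` is power-bounded: `sup_n ‖T ^ n‖ < ∞`. -/
def PowerBounded {X : Type*} [NormedAddCommGroup X] [Module ℍᵐᵒᵖ X] (T : X →L[ℍᵐᵒᵖ] X) : Prop :=
  BddAbove (Set.range fun n : ℕ => opNorm (T ^ n))

section

variable {X : Type*} [NormedAddCommGroup X] [Module ℍ X] [Module ℍᵐᵒᵖ X]
  [SMulCommClass ℍ ℍᵐᵒᵖ X] [NormSMulClass ℍ X]

/-- A scalar on the left of a right linear operator acts by `(s T) v = s (T v)`. -/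
instance smulCommClass_op : SMulCommClass ℍᵐᵒᵖ ℍ X := SMulCommClass.symm ℍ ℍᵐᵒᵖ X

/-- `Q_s(T) = T² - 2 Re(s) T + |s|² I`. -/
def Q (s : ℍ) (T : X →L[ℍᵐᵒᵖ] X) : X →L[ℍᵐᵒᵖ] X :=
  T ^ 2 - ((2 * s.re : ℝ) : ℍ) • T + ((‖s‖ ^ 2 : ℝ) : ℍ) • (1 : X →L[ℍᵐᵒᵖ] X)

/-- The `S`-resolvent set: `Q_s(T)` is invertible in the ring of bounded right linear operators. -/
def sResolventSet (T : X →L[ℍᵐᵒᵖ] X) : Set ℍ :=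
  {s : ℍ | IsUnit (Q s T)}

/-- The `S`-spectrum, the complement of the `S`-resolvent set. -/
def sSpectrum (T : X →L[ℍᵐᵒᵖ] X) : Set ℍ :=
  (sResolventSet T)ᶜ

/-- The peripheral `S`-spectrum: the part of the `S`-spectrum on the boundary of the unit ball. -/
def peripheralSSpectrum (T : X →L[ℍᵐᵒᵖ] X) : Set ℍ :=
  sSpectrum T ∩ frontier (Metric.ball (0 : ℍ) 1)

end

end QuatOp

end

/-!
A right quaternionic Banach space is a complex Banach space, with `ℂ ⊆ ℍ` acting on the right, and
right `ℍ`-linear operators are complex linear for this structure. Real scalars act in the same way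
from both sides (`QuatOp.real_smul_left`), so over `ℂ` the operator `Q_s(T)` factors as
`(z - T) (conj z - T)`, where `z` is a complex number conjugate to `s`. Invertibility does not
depend on whether the inverse is sought among the right `ℍ`-linear or the complex linear operators
(`QuatOp.isUnit_toComplex_iff`). So the condition on the peripheral `S`-spectrum says that the
complex spectrum of `T` meets the unit circle at most at `1`, and the theorem becomes the classical
Katznelson–Tzafriri theorem for an element `a` of a complex Banach algebra.

If `aⁿ - aⁿ⁺¹ → 0`, the spectral mapping theorem bounds the constant `|1 - λ| = |λⁿ - λⁿ⁺¹|` by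
`‖aⁿ - aⁿ⁺¹‖ ‖1‖` for `λ` in the spectrum with `|λ| = 1`, so `λ = 1`.

Conversely, let `φ` be a continuous function on the circle that vanishes near `1` and has an
absolutely convergent Fourier series. Then
`G(t) = φ(t) (1 - exp (-2πit) a)⁻¹` is continuous, and `G(t) - exp (-2πit) a G(t) = φ(t)` gives the
recurrence `Ĝ(n) = φ̂(n) + a Ĝ(n + 1)`. By the Riemann-Lebesgue lemma and power-boundedness it
unfolds to `Ĝ(-n) = ∑ₖ φ̂(k - n) aᵏ`, and this tends to `0` as `n → ∞`, again by the
Riemann-Lebesgue lemma. In the norm of absolutely convergent Fourier series such functions `φ`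
approximate `|1 - z| ^ 6 = -z⁻³ (1 - z) ^ 6` (`norm_coeff_sub_cutoff_le`), for which the series
`∑ₖ φ̂(k - n) aᵏ` is `-aⁿ⁻³ (1 - a) ^ 6`. So `aⁿ (1 - a) ^ 6 → 0`. The exponent is lowered to `1`
one step at a time, since a sequence with uniformly bounded block sums whose increments tend to
zero tends to zero (`tendsto_zero_of_sum_bounded`).
-/

namespace KatznelsonTzafriri

open Filter Topology Complex MeasureTheory

/-! ### Fourier coefficients of functions of period one -/

section FourierCoefficients

variable {E : Type*} [NormedAddCommGroup E] [NormedSpace ℂ E]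

/-- The character `t ↦ exp (2πint)` of `ℝ / ℤ`, as a function on `ℝ`. -/
noncomputable def char (n : ℤ) (t : ℝ) : ℂ := exp (2 * Real.pi * I * n * t)

/-- The `n`-th Fourier coefficient `∫₀¹ exp (-2πint) f(t) dt` of a function on the unit interval. -/
noncomputable def coeff (f : ℝ → E) (n : ℤ) : E := ∫ t in (0 : ℝ)..1, char (-n) t • f t

lemma continuous_char (n : ℤ) : Continuous (char n) := by
  unfold char; fun_prop

lemma char_add (m n : ℤ) (t : ℝ) : char (m + n) t = char m t * char n t := by
  rw [char, char, char, ← Complex.exp_add]; push_cast; congr 1; ring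

lemma char_zero (t : ℝ) : char 0 t = 1 := by simp [char]

lemma norm_char (n : ℤ) (t : ℝ) : ‖char n t‖ = 1 := by
  have : char n t = exp ((2 * Real.pi * n * t : ℝ) * I) := by
    rw [char]; push_cast; congr 1; ring
  rw [this, norm_exp_ofReal_mul_I]

lemma char_at_zero (n : ℤ) : char n 0 = 1 := by simp [char]

lemma char_at_one (n : ℤ) : char n 1 = 1 := by
  rw [char, Complex.exp_eq_one_iff]
  exact ⟨n, by push_cast; ring⟩

lemma intervalIntegrable_char_smul {f : ℝ → E} (hf : Continuous f) (n : ℤ) :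
    IntervalIntegrable (fun t => char n t • f t) volume 0 1 :=
  ((continuous_char n).smul hf).intervalIntegrable _ _

lemma coeff_sub {f g : ℝ → E} (hf : Continuous f) (hg : Continuous g) (n : ℤ) :
    coeff (fun t => f t - g t) n = coeff f n - coeff g n := by
  simp only [coeff, smul_sub]
  exact intervalIntegral.integral_sub (intervalIntegrable_char_smul hf _)
    (intervalIntegrable_char_smul hg _)

lemma coeff_const_mul (c : ℂ) (f : ℝ → ℂ) (n : ℤ) :
    coeff (fun t => c * f t) n = c * coeff f n := by
  rw [coeff, coeff, ← intervalIntegral.integral_const_mul]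
  congr 1; ext t; simp only [smul_eq_mul]; ring

lemma coeff_sum {ι : Type*} (s : Finset ι) {f : ι → ℝ → E} (hf : ∀ i, Continuous (f i)) (n : ℤ) :
    coeff (fun t => ∑ i ∈ s, f i t) n = ∑ i ∈ s, coeff (f i) n := by
  simp only [coeff, Finset.smul_sum]
  exact intervalIntegral.integral_finsetSum fun i _ => intervalIntegrable_char_smul (hf i) _

lemma coeff_smul_const [CompleteSpace E] (f : ℝ → ℂ) (v : E) (n : ℤ) :
    coeff (fun t => f t • v) n = coeff f n • v := by
  rw [coeff, coeff, ← intervalIntegral.integral_smul_const]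
  simp only [smul_smul, smul_eq_mul]

lemma norm_coeff_le {f : ℝ → E} {C : ℝ} (hf : ∀ t, ‖f t‖ ≤ C) (n : ℤ) : ‖coeff f n‖ ≤ C := by
  refine (intervalIntegral.norm_integral_le_of_norm_le_const (C := C) fun t _ => ?_).trans ?_
  · rw [norm_smul, norm_char, one_mul]; exact hf t
  · simp

/-- Multiplication by a character shifts the Fourier coefficients. -/
lemma coeff_char_smul (f : ℝ → E) (m n : ℤ) :
    coeff (fun t => char m t • f t) n = coeff f (n - m) := by
  simp only [coeff, smul_smul, ← char_add]
  congr 2; ext t; congr 2; ring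

lemma hasDerivAt_char (n : ℤ) (t : ℝ) :
    HasDerivAt (char n) (2 * Real.pi * I * n * char n t) t := by
  have h : HasDerivAt (fun s : ℝ => 2 * (Real.pi : ℂ) * I * n * s) (2 * Real.pi * I * n) t := by
    have := (Complex.ofRealCLM.hasDerivAt (x := t)).const_mul (2 * (Real.pi : ℂ) * I * n)
    rwa [Complex.ofRealCLM_apply, Complex.ofReal_one, mul_one] at this
  exact h.cexp.congr_deriv (mul_comm _ _)

/-- Integration by parts. -/
lemma coeff_deriv {f f' : ℝ → ℂ} (hf : ∀ t, HasDerivAt f (f' t) t) (hf' : Continuous f')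
    (h01 : f 0 = f 1) (n : ℤ) : coeff f' n = 2 * Real.pi * I * n * coeff f n := by
  have hfc : Continuous f := continuous_iff_continuousAt.2 fun t => (hf t).continuousAt
  have key : ∫ t in (0 : ℝ)..1,
      (2 * Real.pi * I * (-n : ℤ) * char (-n) t * f t + char (-n) t * f' t) = 0 := by
    rw [intervalIntegral.integral_eq_sub_of_hasDerivAt
      (fun t _ => (hasDerivAt_char (-n) t).mul (hf t))]
    · simp [char_at_zero, char_at_one, h01]
    · have := continuous_char (-n)
      exact Continuous.intervalIntegrable (by fun_prop) _ _
  have e : ∀ t, 2 * Real.pi * I * (-n : ℤ) * char (-n) t * f t =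
      (-(2 * Real.pi * I * n)) * (char (-n) t • f t) := fun t => by
    push_cast; simp only [smul_eq_mul]; ring
  simp only [e] at key
  rw [intervalIntegral.integral_add
    ((intervalIntegrable_char_smul hfc (-n)).const_mul _)
    (by exact intervalIntegrable_char_smul hf' (-n)), intervalIntegral.integral_const_mul] at key
  change -(2 * Real.pi * I * n) * coeff f n + coeff f' n = 0 at key
  linear_combination key

lemma coeff_one (n : ℤ) : coeff (fun _ => (1 : ℂ)) n = if n = 0 then 1 else 0 := by
  split_ifs with h
  · simp [coeff, h, char_zero]
  · have h0 := coeff_deriv (f := fun _ => (1 : ℂ)) (f' := fun _ => 0)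
      (fun t => hasDerivAt_const _ _) continuous_const rfl n
    have hz : coeff (fun _ : ℝ => (0 : ℂ)) n = 0 := by simp [coeff]
    rw [hz] at h0
    have hne : (2 * Real.pi * I * n : ℂ) ≠ 0 := by
      simp [Real.pi_ne_zero, h]
    exact (mul_eq_zero.1 h0.symm).resolve_left hne

lemma coeff_char (m n : ℤ) : coeff (char m) n = if n = m then 1 else 0 := by
  have := coeff_char_smul (fun _ => (1 : ℂ)) m n
  simp only [smul_eq_mul, mul_one] at this
  rw [show coeff (char m) n = coeff (fun t => char m t) n from rfl, this, coeff_one]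
  simp only [sub_eq_zero]

/-- The Riemann-Lebesgue lemma. -/
lemma tendsto_coeff_zero (f : ℝ → E) {u : ℕ → ℤ}
    (hu : Tendsto (fun n => |(u n : ℝ)|) atTop atTop) :
    Tendsto (fun n => coeff f (u n)) atTop (𝓝 0) := by
  have hu' : Tendsto (fun n => (u n : ℝ)) atTop (cocompact ℝ) := by
    refine tendsto_cocompact_of_tendsto_dist_comp_atTop (0 : ℝ) ?_
    simpa [Real.dist_eq] using hu
  have h := (Real.tendsto_integral_exp_smul_cocompact
    ((Set.Ioc (0 : ℝ) 1).indicator f)).comp hu'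
  refine h.congr fun n => ?_
  rw [coeff, intervalIntegral.integral_of_le zero_le_one, ← integral_indicator measurableSet_Ioc]
  refine integral_congr_ae (Eventually.of_forall fun t => ?_)
  by_cases ht : t ∈ Set.Ioc (0 : ℝ) 1
  · simp only [Set.indicator_of_mem ht, Circle.smul_def, Real.fourierChar_apply, char]
    congr 2; push_cast; ring
  · simp [Set.indicator_of_notMem ht]

/-- The Fourier coefficients of a `C²` periodic function decay quadratically. -/
lemma norm_coeff_le_of_deriv_two {f f' f'' : ℝ → ℂ} (hf : ∀ t, HasDerivAt f (f' t) t)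
    (hf' : ∀ t, HasDerivAt f' (f'' t) t) (hf'' : Continuous f'') (h0 : f 0 = f 1)
    (h1 : f' 0 = f' 1) {A B : ℝ} (hA : ∀ t, ‖f t‖ ≤ A) (hB : ∀ t, ‖f'' t‖ ≤ 4 * Real.pi ^ 2 * B)
    (n : ℤ) : ‖coeff f n‖ ≤ (A + B) * (1 / (1 + (n : ℝ) ^ 2)) := by
  have hc' : Continuous f' := continuous_iff_continuousAt.2 fun t => (hf' t).continuousAt
  have e : coeff f'' n = -((4 * Real.pi ^ 2 * n ^ 2 : ℝ) : ℂ) * coeff f n := by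
    rw [coeff_deriv hf' hf'' h1, coeff_deriv hf hc' h0]
    push_cast
    linear_combination 4 * (Real.pi : ℂ) ^ 2 * n ^ 2 * coeff f n * I_sq
  have hb := norm_coeff_le hB n
  rw [e, norm_mul, norm_neg, Complex.norm_real, Real.norm_of_nonneg (by positivity)] at hb
  have hpi : 0 < 4 * Real.pi ^ 2 := by positivity
  have hb' : (n : ℝ) ^ 2 * ‖coeff f n‖ ≤ B := by
    refine le_of_mul_le_mul_left ?_ hpi
    linarith
  rw [mul_one_div, le_div_iff₀ (by positivity)]
  linarith [norm_coeff_le hA n]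

end FourierCoefficients

lemma summable_one_div_one_add_sq : Summable fun m : ℤ => 1 / (1 + (m : ℝ) ^ 2) := by
  refine (Real.summable_one_div_int_pow.2 one_lt_two).of_norm_bounded_eventually ?_
  rw [Filter.eventually_cofinite]
  refine (Set.finite_singleton (0 : ℤ)).subset fun m hm => ?_
  by_contra h0
  refine hm ?_
  have : (0 : ℝ) < (m : ℝ) ^ 2 := by
    have : (m : ℝ) ≠ 0 := by exact_mod_cast h0
    positivity
  rw [Real.norm_of_nonneg (by positivity)]
  exact one_div_le_one_div_of_le this (by linarith)

/-! ### A smooth cutoff at the point `1` of the circle -/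

lemma hasDerivAt_posPart_pow (n : ℕ) (x : ℝ) :
    HasDerivAt (fun y : ℝ => max y 0 ^ (n + 2)) ((n + 2) * max x 0 ^ (n + 1)) x := by
  rcases lt_trichotomy x 0 with h | h | h
  · rw [max_eq_right h.le, zero_pow (by omega), mul_zero]
    refine (hasDerivAt_const x (0 : ℝ)).congr_of_eventuallyEq ?_
    filter_upwards [gt_mem_nhds h] with y hy
    rw [max_eq_right hy.le, zero_pow (by omega)]
  · subst h
    rw [max_self, zero_pow (by omega), mul_zero, hasDerivAt_iff_isLittleO]
    simp only [max_self, sub_zero, smul_zero]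
    rw [zero_pow (by omega)]
    simp only [sub_zero]
    refine Asymptotics.IsBigO.trans_isLittleO (g := fun y : ℝ => y ^ (n + 2)) ?_ ?_
    · refine Asymptotics.IsBigO.of_bound 1 (Eventually.of_forall fun y => ?_)
      rw [one_mul, norm_pow, norm_pow]
      gcongr
      rw [Real.norm_eq_abs, Real.norm_eq_abs, abs_of_nonneg (le_max_right _ _)]
      exact max_le (le_abs_self y) (abs_nonneg y)
    · simpa using Asymptotics.isLittleO_pow_pow (𝕜 := ℝ) (show 1 < n + 2 by omega)
  · rw [max_eq_left h.le]
    have := hasDerivAt_pow (n + 2) x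
    push_cast at this
    refine this.congr_of_eventuallyEq ?_
    filter_upwards [lt_mem_nhds h] with y hy
    rw [max_eq_left hy.le]

/-- `|1 - z|²` at the point `z = exp (2πit)` of the circle. -/
noncomputable def distSq (t : ℝ) : ℝ := 2 - 2 * Real.cos (2 * Real.pi * t)

/-- A `C²` approximation to `distSq ^ 3` that vanishes where `distSq ≤ ε`. -/
noncomputable def cutoff (ε t : ℝ) : ℝ := max (distSq t - ε) 0 ^ 3

lemma continuous_distSq : Continuous distSq := by unfold distSq; fun_prop

lemma continuous_cutoff (ε : ℝ) : Continuous (cutoff ε) := by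
  have := continuous_distSq
  unfold cutoff; fun_prop

lemma distSq_nonneg (t : ℝ) : 0 ≤ distSq t := by
  unfold distSq; linarith [Real.cos_le_one (2 * Real.pi * t)]

lemma distSq_le (t : ℝ) : distSq t ≤ 4 := by
  unfold distSq; linarith [Real.neg_one_le_cos (2 * Real.pi * t)]

lemma ofReal_distSq (t : ℝ) : (distSq t : ℂ) = -(char (-1) t * (1 - char 1 t) ^ 2) := by
  have h : char (-1) t * char 1 t = 1 := by rw [← char_add]; simp [char_zero]
  have hc : (2 * Real.cos (2 * Real.pi * t) : ℂ) = char 1 t + char (-1) t := by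
    rw [Complex.ofReal_cos, Complex.two_cos, char, char]
    push_cast
    congr 2 <;> ring
  have : (distSq t : ℂ) = 2 - 2 * Real.cos (2 * Real.pi * t) := by
    simp [distSq]
  rw [this, hc]
  linear_combination (char 1 t - 2) * h

lemma distSq_eq_zero_of_char_eq_one {t : ℝ} (h : char (-1) t = 1) : distSq t = 0 := by
  have h' : char (-1) t * char 1 t = 1 := by rw [← char_add]; simp [char_zero]
  have h1 : char 1 t = 1 := by rwa [h, one_mul] at h'
  have := ofReal_distSq t
  rw [h1] at this
  simpa using this

lemma hasDerivAt_distSq (t : ℝ) :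
    HasDerivAt distSq (4 * Real.pi * Real.sin (2 * Real.pi * t)) t := by
  have h : HasDerivAt (fun s : ℝ => 2 * Real.pi * s) (2 * Real.pi) t := by
    simpa using (hasDerivAt_id t).const_mul (2 * Real.pi)
  have := (h.cos.const_mul 2).const_sub 2
  refine this.congr_deriv ?_
  ring

lemma hasDerivAt_distSq_deriv (t : ℝ) :
    HasDerivAt (fun t => 4 * Real.pi * Real.sin (2 * Real.pi * t))
      (8 * Real.pi ^ 2 * Real.cos (2 * Real.pi * t)) t := by
  have h : HasDerivAt (fun s : ℝ => 2 * Real.pi * s) (2 * Real.pi) t := by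
    simpa using (hasDerivAt_id t).const_mul (2 * Real.pi)
  refine (h.sin.const_mul (4 * Real.pi)).congr_deriv ?_
  ring

/-- The cutoff changes `distSq ^ 3` only by `O(ε)` in `C²`, hence also in the norm of absolutely
convergent Fourier series. -/
lemma norm_coeff_sub_cutoff_le {ε : ℝ} (hε : 0 ≤ ε) (n : ℤ) :
    ‖coeff (fun t => ((distSq t ^ 3 - cutoff ε t : ℝ) : ℂ)) n‖ ≤
      120 * ε * (1 / (1 + (n : ℝ) ^ 2)) := by
  set s : ℝ → ℝ := fun t => 4 * Real.pi * Real.sin (2 * Real.pi * t) with hs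
  set c : ℝ → ℝ := fun t => 8 * Real.pi ^ 2 * Real.cos (2 * Real.pi * t) with hc
  set p : ℝ → ℝ := fun t => max (distSq t - ε) 0 with hp
  have hd : ∀ (k : ℕ) (t : ℝ),
      HasDerivAt (fun t => p t ^ (k + 2)) ((k + 2) * p t ^ (k + 1) * s t) t := fun k t =>
    HasDerivAt.comp t (h₂ := fun y : ℝ => max y 0 ^ (k + 2))
      (hasDerivAt_posPart_pow k (distSq t - ε)) ((hasDerivAt_distSq t).sub_const ε)
  have hd3 : ∀ t, HasDerivAt (cutoff ε) (3 * p t ^ 2 * s t) t := fun t =>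
    (hd 1 t).congr_deriv (by norm_num)
  have hd2 : ∀ t, HasDerivAt (fun t => p t ^ 2) (2 * p t * s t) t := fun t =>
    (hd 0 t).congr_deriv (by simp)
  have hf : ∀ t, HasDerivAt (fun t => distSq t ^ 3 - cutoff ε t)
      ((3 * distSq t ^ 2 - 3 * p t ^ 2) * s t) t := fun t => by
    refine (((hasDerivAt_distSq t).fun_pow 3).fun_sub (hd3 t)).congr_deriv ?_
    simp only [hs]; push_cast; ring
  have hf' : ∀ t, HasDerivAt (fun t => (3 * distSq t ^ 2 - 3 * p t ^ 2) * s t)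
      ((6 * distSq t - 6 * p t) * s t ^ 2 + (3 * distSq t ^ 2 - 3 * p t ^ 2) * c t) t := fun t => by
    have h2 := ((((hasDerivAt_distSq t).fun_pow 2).const_mul 3).fun_sub
      ((hd2 t).const_mul 3)).fun_mul (hasDerivAt_distSq_deriv t)
    refine h2.congr_deriv ?_
    simp only [hs, hc]; push_cast; ring
  have hcont : Continuous fun t =>
      (6 * distSq t - 6 * p t) * s t ^ 2 + (3 * distSq t ^ 2 - 3 * p t ^ 2) * c t := by
    have := continuous_distSq
    simp only [hs, hc, hp]; fun_prop
  have h01 : distSq 0 = distSq 1 := by simp [distSq]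
  have hs0 : s 0 = 0 := by simp [hs]
  have hs1 : s 1 = 0 := by simp [hs]
  -- `0 ≤ distSq - p ≤ ε` and `0 ≤ p ≤ distSq ≤ 4`
  have hp0 : ∀ t, 0 ≤ p t := fun t => le_max_right _ _
  have hpu : ∀ t, p t ≤ distSq t := fun t => max_le (by linarith) (distSq_nonneg t)
  have hpe : ∀ t, distSq t - p t ≤ ε := fun t => by
    have := le_max_left (distSq t - ε) 0
    simp only [hp]; linarith
  have hsq : ∀ t, |distSq t ^ 2 - p t ^ 2| ≤ 8 * ε := fun t => by
    have h1 := hp0 t; have h2 := hpu t; have h3 := hpe t; have h4 := distSq_le t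
    rw [abs_of_nonneg (by nlinarith)]
    nlinarith
  have hcu : ∀ t, |distSq t ^ 3 - p t ^ 3| ≤ 48 * ε := fun t => by
    have h1 := hp0 t; have h2 := hpu t; have h3 := hpe t; have h4 := distSq_le t
    have e : distSq t ^ 3 - p t ^ 3 =
      (distSq t - p t) * (distSq t ^ 2 + distSq t * p t + p t ^ 2) := by ring
    have hq : distSq t ^ 2 + distSq t * p t + p t ^ 2 ≤ 48 := by nlinarith
    have hq0 : 0 ≤ distSq t ^ 2 + distSq t * p t + p t ^ 2 := by nlinarith
    rw [e, abs_of_nonneg (mul_nonneg (by linarith) hq0)]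
    nlinarith
  have hA : ∀ t, ‖((distSq t ^ 3 - cutoff ε t : ℝ) : ℂ)‖ ≤ 48 * ε := fun t => by
    rw [Complex.norm_real]; exact hcu t
  have hB : ∀ t, ‖(((6 * distSq t - 6 * p t) * s t ^ 2 +
      (3 * distSq t ^ 2 - 3 * p t ^ 2) * c t : ℝ) : ℂ)‖ ≤ 4 * Real.pi ^ 2 * (72 * ε) := fun t => by
    rw [Complex.norm_real, Real.norm_eq_abs]
    have hS : |s t ^ 2| ≤ 16 * Real.pi ^ 2 := by
      rw [abs_of_nonneg (sq_nonneg _)]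
      have := Real.sin_sq_le_one (2 * Real.pi * t)
      simp only [hs, mul_pow]
      nlinarith [sq_nonneg Real.pi]
    have hC : |c t| ≤ 8 * Real.pi ^ 2 := by
      simp only [hc]
      rw [abs_mul, abs_of_nonneg (by positivity)]
      exact mul_le_of_le_one_right (by positivity) (Real.abs_cos_le_one _)
    have h1 : |6 * distSq t - 6 * p t| ≤ 6 * ε := by
      rw [abs_of_nonneg (by linarith [hpu t])]; linarith [hpe t]
    have h2 : |3 * distSq t ^ 2 - 3 * p t ^ 2| ≤ 24 * ε := by
      rw [← mul_sub, abs_mul, abs_of_nonneg (by norm_num : (0 : ℝ) ≤ 3)]; linarith [hsq t]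
    calc _ ≤ |6 * distSq t - 6 * p t| * |s t ^ 2| + |3 * distSq t ^ 2 - 3 * p t ^ 2| * |c t| := by
          rw [← abs_mul, ← abs_mul]; exact abs_add_le _ _
      _ ≤ 6 * ε * (16 * Real.pi ^ 2) + 24 * ε * (8 * Real.pi ^ 2) := by gcongr
      _ = _ := by ring
  have := norm_coeff_le_of_deriv_two (fun t => (hf t).ofReal_comp) (fun t => (hf' t).ofReal_comp)
    (continuous_ofReal.comp hcont) (by simp [cutoff, h01]) (by simp [hs0, hs1]) hA hB n
  refine this.trans (le_of_eq ?_)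
  ring

/-! ### The Katznelson–Tzafriri theorem in a complex Banach algebra -/

section BanachAlgebra

variable {A : Type*} [NormedRing A] [NormedAlgebra ℂ A]

/-- The resolvent-type function `φ(t) (1 - exp (-2πit) a)⁻¹` on the circle. The inverse has the
junk value `0` where it does not exist, so this is of use when `φ` vanishes near such points. -/
noncomputable def cutResolvent (φ : ℝ → ℂ) (a : A) (t : ℝ) : A :=
  φ t • Ring.inverse (1 - char (-1) t • a)

/-- The trigonometric polynomial `distSq ^ 3` is a shift of `(1 - z) ^ 6`. -/
lemma ofReal_distSq_pow (t : ℝ) :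
    ((distSq t ^ 3 : ℝ) : ℂ) =
      ∑ j ∈ Finset.range 7, (-((-1) ^ j * (Nat.choose 6 j : ℂ))) * char (j - 3) t := by
  have h3 : char (-1) t ^ 3 = char (-3) t := by
    rw [pow_three, ← char_add, ← char_add]; norm_num
  have hj : ∀ j : ℕ, char j t = char 1 t ^ j := fun j => by
    rw [char, char, ← Complex.exp_nat_mul]; congr 1; push_cast; ring
  have e : ((distSq t ^ 3 : ℝ) : ℂ) = -(char (-3) t * (-char 1 t + 1) ^ 6) := by
    rw [Complex.ofReal_pow, ofReal_distSq, ← h3]; ring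
  rw [e, add_pow, Finset.mul_sum, ← Finset.sum_neg_distrib]
  refine Finset.sum_congr rfl fun j _ => ?_
  rw [sub_eq_add_neg, add_comm (j : ℤ), char_add, hj, neg_pow (char 1 t), one_pow]
  ring

/-- The series `∑ₖ f̂(k - n - 3) aᵏ` for `f = distSq ^ 3`. The frequencies of `f` start at `-3`, so
for natural `n` no term is lost by restricting to `k ≥ 0`. -/
lemma hasSum_coeff_distSq (a : A) (n : ℕ) :
    HasSum (fun k : ℕ => coeff (fun t => ((distSq t ^ 3 : ℝ) : ℂ)) (k - (n + 3 : ℕ)) • a ^ k)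
      (-(a ^ n * (1 - a) ^ 6)) := by
  have hterm : ∀ j : ℕ, HasSum (fun k : ℕ =>
      (-((-1) ^ j * (Nat.choose 6 j : ℂ)) * coeff (char (j - 3)) (k - (n + 3 : ℕ))) • a ^ k)
      ((-((-1) ^ j * (Nat.choose 6 j : ℂ))) • a ^ (n + j)) := fun j => by
    have : ∀ k : ℕ, coeff (char (j - 3)) (k - (n + 3 : ℕ)) = if k = n + j then 1 else 0 :=
      fun k => by
        rw [coeff_char]
        refine if_congr ?_ rfl rfl
        push_cast; omega
    simp only [this]
    convert! hasSum_ite_eq (n + j) ((-((-1) ^ j * (Nat.choose 6 j : ℂ))) • a ^ (n + j))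
      using 2 with k
    split_ifs with hk
    · rw [hk, mul_one]
    · rw [mul_zero, zero_smul]
  have hs := hasSum_sum (s := Finset.range 7) fun j _ => hterm j
  convert! hs using 1
  · funext k
    rw [← Finset.sum_smul]
    congr 1
    simp only [ofReal_distSq_pow]
    rw [coeff_sum _ fun j : ℕ => Continuous.fun_mul continuous_const (continuous_char _)]
    simp only [coeff_const_mul]
  · rw [sub_eq_add_neg, add_comm, (Commute.one_right (-a)).add_pow, Finset.mul_sum,
      ← Finset.sum_neg_distrib]
    refine Finset.sum_congr rfl fun j _ => ?_
    rw [one_pow, mul_one, neg_pow a, pow_add, neg_smul, mul_smul, Nat.cast_smul_eq_nsmul,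
      nsmul_eq_mul]
    congr 1
    have hcomm := (Nat.cast_commute (Nat.choose 6 j) (a ^ n * a ^ j)).eq
    rcases Nat.even_or_odd j with h | h
    · simp only [h.neg_one_pow, one_mul, one_smul]
      rw [hcomm, mul_assoc]
    · simp only [h.neg_one_pow, neg_mul, mul_neg, one_mul, neg_smul, one_smul]
      rw [hcomm, mul_assoc]

variable [CompleteSpace A]

lemma continuous_cutResolvent {φ : ℝ → ℂ} (hφ : Continuous φ) {a : A}
    (h0 : ∀ t, char (-1) t = 1 → ∀ᶠ s in 𝓝 t, φ s = 0)
    (hu : ∀ z : ℂ, ‖z‖ = 1 → z ≠ 1 → IsUnit (1 - z • a)) :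
    Continuous (cutResolvent φ a) := by
  refine continuous_iff_continuousAt.2 fun t => ?_
  by_cases ht : char (-1) t = 1
  · refine (continuousAt_const (y := (0 : A))).congr ?_
    filter_upwards [h0 t ht] with s hs
    simp [cutResolvent, hs]
  · obtain ⟨u, hu⟩ := hu _ (norm_char _ t) ht
    have h := NormedRing.inverse_continuousAt u
    rw [hu] at h
    refine hφ.continuousAt.smul (ContinuousAt.comp (f := fun t => 1 - char (-1) t • a) h ?_)
    exact (continuous_const.sub ((continuous_char _).smul continuous_const)).continuousAt

lemma coeff_mul_left (a : A) {f : ℝ → A} (hf : Continuous f) (n : ℤ) :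
    coeff (fun t => a * f t) n = a * coeff f n := by
  have := (ContinuousLinearMap.mul ℂ A a).intervalIntegral_comp_comm
    (intervalIntegrable_char_smul hf (-n))
  simpa [coeff] using this

lemma coeff_cutResolvent_sub {φ : ℝ → ℂ} (hφ : Continuous φ) {a : A}
    (h0 : ∀ t, char (-1) t = 1 → ∀ᶠ s in 𝓝 t, φ s = 0)
    (hu : ∀ z : ℂ, ‖z‖ = 1 → z ≠ 1 → IsUnit (1 - z • a)) (n : ℤ) :
    coeff (cutResolvent φ a) n =
      coeff φ n • (1 : A) + a * coeff (cutResolvent φ a) (n + 1) := by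
  have hc := continuous_cutResolvent hφ h0 hu
  have hc' : Continuous fun t => char (-1) t • cutResolvent φ a t := (continuous_char _).smul hc
  have e : ∀ t, cutResolvent φ a t - a * (char (-1) t • cutResolvent φ a t) = φ t • (1 : A) := by
    intro t
    by_cases ht : char (-1) t = 1
    · simp [cutResolvent, (h0 t ht).self_of_nhds]
    · have := Ring.mul_inverse_cancel _ (hu _ (norm_char _ t) ht)
      rw [mul_smul_comm, ← smul_mul_assoc, ← one_sub_mul, cutResolvent, mul_smul_comm, this]
  have h := coeff_smul_const φ (1 : A) n
  simp only [← e] at h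
  rw [coeff_sub hc (Continuous.fun_mul continuous_const hc'), coeff_mul_left a hc', coeff_char_smul,
    sub_neg_eq_add] at h
  rw [← h]; abel

/-- Iterating `coeff_cutResolvent_sub` expands the Fourier coefficients of the cut-off resolvent
into a power series in `a`. The remainder vanishes by the Riemann-Lebesgue lemma. -/
lemma hasSum_coeff_cutResolvent {φ : ℝ → ℂ} (hφ : Continuous φ) {a : A} {M : ℝ}
    (hM : ∀ n, ‖a ^ n‖ ≤ M) (h0 : ∀ t, char (-1) t = 1 → ∀ᶠ s in 𝓝 t, φ s = 0)
    (hu : ∀ z : ℂ, ‖z‖ = 1 → z ≠ 1 → IsUnit (1 - z • a)) (n : ℤ)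
    (hs : Summable fun k : ℕ => coeff φ (k + n) • a ^ k) :
    HasSum (fun k : ℕ => coeff φ (k + n) • a ^ k) (coeff (cutResolvent φ a) n) := by
  have hM0 : 0 ≤ M := (norm_nonneg _).trans (hM 0)
  refine hs.hasSum_iff_tendsto_nat.2 ?_
  have e : ∀ K : ℕ, ∑ k ∈ Finset.range K, coeff φ (k + n) • a ^ k =
      coeff (cutResolvent φ a) n - a ^ K * coeff (cutResolvent φ a) (K + n) := by
    intro K
    induction K with
    | zero => simp
    | succ K ih =>
      rw [Finset.sum_range_succ, ih, coeff_cutResolvent_sub hφ h0 hu (K + n), mul_add,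
        mul_smul_comm, mul_one, ← mul_assoc, ← pow_succ]
      push_cast
      rw [show (K : ℤ) + n + 1 = K + 1 + n by ring]
      abel
  simp only [e]
  have hrl : Tendsto (fun K : ℕ => coeff (cutResolvent φ a) (K + n)) atTop (𝓝 0) := by
    refine tendsto_coeff_zero _ ?_
    push_cast
    exact tendsto_abs_atTop_atTop.comp
      (tendsto_atTop_add_const_right _ _ tendsto_natCast_atTop_atTop)
  have hrem : Tendsto (fun K : ℕ => a ^ K * coeff (cutResolvent φ a) (K + n)) atTop (𝓝 0) := by
    refine squeeze_zero_norm (fun K => (norm_mul_le _ _).trans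
      (mul_le_mul_of_nonneg_right (hM K) (norm_nonneg _))) ?_
    simpa using hrl.norm.const_mul M
  simpa using tendsto_const_nhds.sub hrem

/-- A power-bounded element whose spectrum meets the unit circle at most at `1` satisfies
`aⁿ (1 - a) ^ 6 → 0`. -/
lemma tendsto_pow_mul_one_sub_pow_six {a : A} {M : ℝ} (hM : ∀ n, ‖a ^ n‖ ≤ M)
    (hu : ∀ z : ℂ, ‖z‖ = 1 → z ≠ 1 → IsUnit (1 - z • a)) :
    Tendsto (fun n : ℕ => a ^ n * (1 - a) ^ 6) atTop (𝓝 0) := by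
  have hM0 : 0 ≤ M := (norm_nonneg _).trans (hM 0)
  set S : ℝ := ∑' m : ℤ, 1 / (1 + (m : ℝ) ^ 2) with hS
  have hS0 : 0 ≤ S := tsum_nonneg fun m => by positivity
  rw [Metric.tendsto_atTop]
  intro δ hδ
  obtain ⟨ε, hε, hεδ⟩ : ∃ ε > 0, 120 * ε * M * S < δ / 2 := by
    refine ⟨δ / 2 / (120 * M * S + 1), by positivity, ?_⟩
    rw [show 120 * (δ / 2 / (120 * M * S + 1)) * M * S =
      (δ / 2) * ((120 * M * S) / (120 * M * S + 1)) by ring]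
    refine mul_lt_of_lt_one_right (by positivity) ?_
    rw [div_lt_one (by positivity)]
    linarith
  set φ : ℝ → ℂ := fun t => (cutoff ε t : ℂ) with hφdef
  have hφ : Continuous φ := continuous_ofReal.comp (continuous_cutoff ε)
  have hψ : Continuous fun t => ((distSq t ^ 3 : ℝ) : ℂ) :=
    continuous_ofReal.comp (continuous_distSq.pow 3)
  have h0 : ∀ t, char (-1) t = 1 → ∀ᶠ s in 𝓝 t, φ s = 0 := fun t ht => by
    have h := (continuous_distSq.tendsto t).eventually
      (gt_mem_nhds (show distSq t < ε by rwa [distSq_eq_zero_of_char_eq_one ht]))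
    filter_upwards [h] with s hs
    simp [hφdef, cutoff, max_eq_right (sub_nonpos.2 (le_of_lt hs))]
  set d : ℤ → ℂ := coeff fun t => ((distSq t ^ 3 - cutoff ε t : ℝ) : ℂ) with hd
  have hdiff : ∀ m, coeff φ m = coeff (fun t => ((distSq t ^ 3 : ℝ) : ℂ)) m - d m := fun m => by
    have := coeff_sub hψ hφ m
    simp only [hφdef, ← Complex.ofReal_sub] at this
    rw [hd, this]; ring
  have hdb : ∀ m, ‖d m‖ ≤ 120 * ε * (1 / (1 + (m : ℝ) ^ 2)) := norm_coeff_sub_cutoff_le hε.le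
  -- the error made by the cutoff, uniformly in `n`
  have hinj : ∀ n : ℤ, Function.Injective fun k : ℕ => (k : ℤ) - n := fun n i j h => by
    simpa using h
  have hsum : ∀ n : ℤ, Summable fun k : ℕ => 1 / (1 + (((k : ℤ) - n : ℤ) : ℝ) ^ 2) := fun n =>
    summable_one_div_one_add_sq.comp_injective (hinj n)
  have hterm : ∀ (n : ℤ) (k : ℕ),
      ‖d (k - n) • a ^ k‖ ≤ 120 * ε * M * (1 / (1 + (((k : ℤ) - n : ℤ) : ℝ) ^ 2)) := fun n k => by
    rw [norm_smul]
    calc _ ≤ 120 * ε * (1 / (1 + (((k : ℤ) - n : ℤ) : ℝ) ^ 2)) * M := by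
          gcongr
          · exact hdb _
          · exact hM k
      _ = _ := by ring
  have hdsum : ∀ n : ℤ, Summable fun k : ℕ => d (k - n) • a ^ k := fun n =>
    ((hsum n).mul_left _).of_norm_bounded (hterm n)
  have hdle : ∀ n : ℤ, ‖∑' k : ℕ, d (k - n) • a ^ k‖ ≤ 120 * ε * M * S := fun n => by
    refine (tsum_of_norm_bounded ((hsum n).mul_left _).hasSum (hterm n)).trans ?_
    rw [tsum_mul_left]
    gcongr
    exact tsum_comp_le_tsum_of_inj summable_one_div_one_add_sq (fun m => by positivity) (hinj n)
  have hrepr : ∀ n : ℕ, a ^ n * (1 - a) ^ 6 =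
      -(coeff (cutResolvent φ a) (-(n + 3 : ℕ)) + ∑' k : ℕ, d (k - (n + 3 : ℕ)) • a ^ k) := by
    intro n
    have h1 := hasSum_coeff_distSq a n
    have h2 := (hdsum (n + 3 : ℕ)).hasSum
    have h3 := h1.sub h2
    simp only [← sub_smul, ← hdiff] at h3
    have h4 := hasSum_coeff_cutResolvent hφ hM h0 hu (-(n + 3 : ℕ))
      (by simpa only [← sub_eq_add_neg] using h3.summable)
    simp only [← sub_eq_add_neg] at h4
    rw [← h3.unique h4]
    abel
  have hrl : Tendsto (fun n : ℕ => coeff (cutResolvent φ a) (-(n + 3 : ℕ))) atTop (𝓝 0) := by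
    refine tendsto_coeff_zero _ ?_
    have : ∀ n : ℕ, |((-(n + 3 : ℕ) : ℤ) : ℝ)| = n + 3 := fun n => by
      push_cast
      rw [abs_neg, abs_of_nonneg (by positivity)]
    simp only [this]
    exact tendsto_atTop_add_const_right _ _ tendsto_natCast_atTop_atTop
  obtain ⟨N, hN⟩ := Metric.tendsto_atTop.1 hrl (δ / 2) (by positivity)
  refine ⟨N, fun n hn => ?_⟩
  have := hN n hn
  rw [dist_zero_right] at this ⊢
  rw [hrepr, norm_neg]
  refine (norm_add_le _ _).trans_lt ?_
  linarith [hdle (n + 3 : ℕ)]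

end BanachAlgebra

/-- A sequence with uniformly bounded block sums whose increments tend to zero tends to zero. -/
lemma tendsto_zero_of_sum_bounded {E : Type*} [NormedAddCommGroup E] [NormedSpace ℝ E]
    {d : ℕ → E} {C : ℝ} (hd : Tendsto (fun n => d (n + 1) - d n) atTop (𝓝 0))
    (hC : ∀ n k, ‖∑ i ∈ Finset.range k, d (n + i)‖ ≤ C) : Tendsto d atTop (𝓝 0) := by
  have hC0 : 0 ≤ C := (norm_nonneg _).trans (hC 0 0)
  have hshift : ∀ i : ℕ, Tendsto (fun n => d (n + i) - d n) atTop (𝓝 0) := by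
    intro i
    induction i with
    | zero => simp
    | succ i ih =>
      have h1 : Tendsto (fun n => d (n + i + 1) - d (n + i)) atTop (𝓝 0) :=
        hd.comp (tendsto_add_atTop_nat i)
      simpa [add_assoc] using h1.add ih
  rw [Metric.tendsto_atTop]
  intro δ hδ
  obtain ⟨k, hk⟩ := exists_nat_gt (2 * C / δ)
  have hk0 : (0 : ℝ) < k := lt_of_le_of_lt (by positivity) hk
  have hsum : Tendsto (fun n => ∑ i ∈ Finset.range k, (d (n + i) - d n)) atTop (𝓝 0) := by
    simpa using tendsto_finsetSum (Finset.range k) fun i _ => hshift i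
  obtain ⟨N, hN⟩ := Metric.tendsto_atTop.1 hsum (k * δ / 2) (by positivity)
  refine ⟨N, fun n hn => ?_⟩
  have h1 := hN n hn
  rw [dist_zero_right] at h1 ⊢
  have e : (k : ℝ) • d n =
      ∑ i ∈ Finset.range k, d (n + i) - ∑ i ∈ Finset.range k, (d (n + i) - d n) := by
    rw [Finset.sum_sub_distrib, Finset.sum_const, Finset.card_range, Nat.cast_smul_eq_nsmul]
    abel
  have h2 : k * ‖d n‖ ≤ C + ‖∑ i ∈ Finset.range k, (d (n + i) - d n)‖ := by
    rw [← Real.norm_of_nonneg hk0.le, ← norm_smul, e]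
    exact (norm_sub_le _ _).trans (by gcongr; exact hC n k)
  rw [div_lt_iff₀ hδ] at hk
  have : k * ‖d n‖ < k * δ := by linarith
  exact lt_of_mul_lt_mul_left this hk0.le

/-- For a power-bounded element, `aⁿ (1 - a)ᵐ → 0` with some `m ≥ 1` gives the same for `m = 1`. -/
lemma tendsto_pow_mul_one_sub_of_pow {A : Type*} [NormedRing A] [NormedSpace ℝ A] {a : A} {M : ℝ}
    (hM : ∀ n, ‖a ^ n‖ ≤ M) (m : ℕ)
    (h : Tendsto (fun n : ℕ => a ^ n * (1 - a) ^ (m + 1)) atTop (𝓝 0)) :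
    Tendsto (fun n : ℕ => a ^ n * (1 - a)) atTop (𝓝 0) := by
  induction m with
  | zero => simpa using h
  | succ m ih =>
    refine ih (tendsto_zero_of_sum_bounded (C := (M + M) * ‖(1 - a) ^ m‖) ?_ fun n k => ?_)
    · refine (neg_zero (G := A) ▸ h.neg).congr fun n => ?_
      rw [pow_succ' (1 - a) (m + 1), pow_succ a n]
      noncomm_ring
    · have e : ∑ i ∈ Finset.range k, a ^ (n + i) * (1 - a) ^ (m + 1) =
          (a ^ n - a ^ (n + k)) * (1 - a) ^ m := by
        induction k with
        | zero => simp
        | succ k ih =>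
          rw [Finset.sum_range_succ, ih, pow_succ' (1 - a) m, ← add_assoc n k 1, pow_succ a (n + k)]
          noncomm_ring
      rw [e]
      refine (norm_mul_le _ _).trans ?_
      gcongr
      exact (norm_sub_le _ _).trans (add_le_add (hM _) (hM _))

/-- The **Katznelson–Tzafriri theorem**: if `a` is power-bounded and its spectrum meets the unit
circle at most at `1`, then `aⁿ - aⁿ⁺¹ → 0`. -/
theorem tendsto_pow_sub_pow_succ {A : Type*} [NormedRing A] [NormedAlgebra ℂ A] [CompleteSpace A]
    {a : A} {M : ℝ} (hM : ∀ n, ‖a ^ n‖ ≤ M)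
    (ha : ∀ z ∈ spectrum ℂ a, ‖z‖ = 1 → z = 1) :
    Tendsto (fun n : ℕ => a ^ n - a ^ (n + 1)) atTop (𝓝 0) := by
  have hu : ∀ z : ℂ, ‖z‖ = 1 → z ≠ 1 → IsUnit (1 - z • a) := fun z hz hz1 => by
    have hz0 : z ≠ 0 := by rintro rfl; simp at hz
    have h : IsUnit (algebraMap ℂ A z⁻¹ - a) := by
      by_contra hcon
      exact hz1 (inv_eq_one.1 (ha _ hcon (by simp [hz])))
    have e : 1 - z • a = algebraMap ℂ A z * (algebraMap ℂ A z⁻¹ - a) := by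
      rw [mul_sub, ← map_mul, mul_inv_cancel₀ hz0, map_one, Algebra.smul_def]
    rw [e]
    exact ((IsUnit.mk0 z hz0).map (algebraMap ℂ A)).mul h
  refine (tendsto_pow_mul_one_sub_of_pow hM 5 (tendsto_pow_mul_one_sub_pow_six hM hu)).congr
    fun n => ?_
  rw [mul_sub, mul_one, pow_succ]

/-- If `aⁿ - aⁿ⁺¹ → 0` then the spectrum of `a` meets the unit circle at most at `1`, because
`λⁿ - λⁿ⁺¹`, of modulus `|1 - λ|`, lies in the spectrum of `aⁿ - aⁿ⁺¹`. -/
theorem eq_one_of_mem_spectrum {A : Type*} [NormedRing A] [NormedAlgebra ℂ A] [CompleteSpace A]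
    {a : A} (h : Tendsto (fun n : ℕ => a ^ n - a ^ (n + 1)) atTop (𝓝 0))
    {z : ℂ} (hz : z ∈ spectrum ℂ a) (hz1 : ‖z‖ = 1) : z = 1 := by
  have hb : ∀ n : ℕ, ‖1 - z‖ ≤ ‖a ^ n - a ^ (n + 1)‖ * ‖(1 : A)‖ := fun n => by
    have hm := spectrum.subset_polynomial_aeval a (Polynomial.X ^ n - Polynomial.X ^ (n + 1))
      ⟨z, hz, rfl⟩
    have := spectrum.norm_le_norm_mul_of_mem hm
    simp only [map_sub, map_pow, Polynomial.aeval_X, Polynomial.eval_sub, Polynomial.eval_pow,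
      Polynomial.eval_X] at this
    rwa [pow_succ z, ← mul_one_sub, norm_mul, norm_pow, hz1, one_pow, one_mul] at this
  have hlim : Tendsto (fun n : ℕ => ‖a ^ n - a ^ (n + 1)‖ * ‖(1 : A)‖) atTop (𝓝 0) := by
    simpa using h.norm.mul_const ‖(1 : A)‖
  have h0 : ‖1 - z‖ ≤ 0 := ge_of_tendsto' hlim hb
  exact (sub_eq_zero.1 (norm_le_zero_iff.1 h0)).symm

end KatznelsonTzafriri

namespace QuatOp

/-! ### Right quaternionic operators as complex operators -/

/-- The embedding of `ℂ` into `ℍᵐᵒᵖ` through `a + bi`, a ring homomorphism since `ℂ` is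
commutative. -/
noncomputable def complexToOp : ℂ →+* ℍᵐᵒᵖ :=
  (Quaternion.ofComplex : ℂ →+* ℍ).toOpposite fun x y => by
    rw [Commute, SemiconjBy, ← map_mul, ← map_mul, mul_comm]

lemma complexToOp_apply (z : ℂ) : complexToOp z = MulOpposite.op (z : ℍ) := rfl

lemma norm_coeComplex (z : ℂ) : ‖(z : ℍ)‖ = ‖z‖ := by
  rw [← sq_eq_sq₀ (norm_nonneg _) (norm_nonneg _), sq, ← Quaternion.normSq_eq_norm_mul_self,
    Quaternion.normSq_def', Complex.sq_norm, Complex.normSq_apply]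
  simp [sq]

/-- A right quaternionic Banach space is a complex Banach space, with `ℂ ⊆ ℍ` acting on the
right. -/
@[reducible] noncomputable def complexNormedSpace (X : Type*) [NormedAddCommGroup X]
    [Module ℍᵐᵒᵖ X] [NormSMulClass ℍᵐᵒᵖ X] : NormedSpace ℂ X where
  __ := Module.compHom X complexToOp
  norm_smul_le z x := by
    change ‖complexToOp z • x‖ ≤ _
    rw [norm_smul, complexToOp_apply, MulOpposite.norm_op, norm_coeComplex]

section

variable {X : Type*} [NormedAddCommGroup X] [Module ℍᵐᵒᵖ X] [NormSMulClass ℍᵐᵒᵖ X]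

attribute [local instance] complexNormedSpace

/-- Right linear operators are complex linear. -/
noncomputable def toComplex : (X →L[ℍᵐᵒᵖ] X) →+* (X →L[ℂ] X) where
  toFun T :=
    { toFun := T
      map_add' := T.map_add
      map_smul' := fun z x => T.map_smul (MulOpposite.op (z : ℍ)) x
      cont := T.cont }
  map_one' := rfl
  map_mul' _ _ := rfl
  map_zero' := rfl
  map_add' _ _ := rfl

@[simp] lemma toComplex_apply (T : X →L[ℍᵐᵒᵖ] X) (x : X) : toComplex T x = T x := rfl

lemma opNorm_eq_norm_toComplex (T : X →L[ℍᵐᵒᵖ] X) : opNorm T = ‖toComplex T‖ := rfl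

/-- A right linear operator that is invertible as a complex operator has a right linear inverse. -/
lemma isUnit_toComplex_iff {T : X →L[ℍᵐᵒᵖ] X} : IsUnit (toComplex T) ↔ IsUnit T := by
  refine ⟨fun h => ?_, fun h => h.map toComplex⟩
  obtain ⟨S, hTS, hST⟩ := isUnit_iff_exists.1 h
  have h1 : ∀ x, T (S x) = x := fun x => DFunLike.congr_fun hTS x
  have h2 : ∀ x, S (T x) = x := fun x => DFunLike.congr_fun hST x
  let S' : X →L[ℍᵐᵒᵖ] X :=
    { toFun := S
      map_add' := S.map_add
      map_smul' := fun q x => by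
        conv_lhs => rw [← h1 x, ← T.map_smul]
        exact h2 _
      cont := S.cont }
  exact isUnit_iff_exists.2 ⟨S', ContinuousLinearMap.ext h1, ContinuousLinearMap.ext h2⟩

variable [Module ℍ X] [NormSMulClass ℍ X]

/-- Real scalars act in the same way from the left and from the right: both actions are additive
and continuous, hence agree with the only real vector space structure. -/
lemma real_smul_left (r : ℝ) (x : X) : (r : ℍ) • x = (r : ℂ) • x := by
  let f : ℝ →+ X :=
    { toFun := fun r => (r : ℍ) • x
      map_zero' := by simp
      map_add' := fun r s => by rw [Quaternion.coe_add, add_smul] }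
  have hf : Continuous f := Quaternion.continuous_coe.smul continuous_const
  have h := map_real_smul f hf r 1
  rw [smul_eq_mul, mul_one] at h
  refine h.trans ?_
  change r • (((1 : ℝ) : ℍ) • x) = _
  rw [Quaternion.coe_one, one_smul, Complex.coe_smul]

variable [SMulCommClass ℍ ℍᵐᵒᵖ X]

/-- Over `ℂ`, the operator `Q_s(T)` factors as `(z - T) (conj z - T)`, where `z` is a complex
number with the real part and modulus of `s`. -/
lemma toComplex_Q {s : ℍ} {z : ℂ} (hre : z.re = s.re) (hnorm : ‖z‖ = ‖s‖) (T : X →L[ℍᵐᵒᵖ] X) :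
    toComplex (Q s T) = (algebraMap ℂ (X →L[ℂ] X) z - toComplex T) *
      (algebraMap ℂ (X →L[ℂ] X) (starRingEnd ℂ z) - toComplex T) := by
  have h1 : ((2 * s.re : ℝ) : ℂ) = z + starRingEnd ℂ z := by rw [Complex.add_conj, hre]
  have h2 : ((‖s‖ ^ 2 : ℝ) : ℂ) = z * starRingEnd ℂ z := by
    rw [Complex.mul_conj, Complex.normSq_eq_norm_sq, hnorm]
  ext x
  have e : toComplex (Q s T) x =
      T (T x) - ((2 * s.re : ℝ) : ℍ) • T x + ((‖s‖ ^ 2 : ℝ) : ℍ) • x := by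
    simp [Q, pow_two]
  rw [e, real_smul_left, real_smul_left, h1, h2]
  have hT : ∀ (w : ℂ) (y : X), T (w • y) = w • T y := fun w y => (toComplex T).map_smul w y
  simp only [mul_apply_eq_comp, sub_apply, ContinuousLinearMap.algebraMap_apply,
    toComplex_apply, map_sub, hT, smul_smul, add_smul]
  abel

/-- The `S`-spectrum of `T` is the set of quaternions conjugate to a point of the complex
spectrum. -/
lemma mem_sSpectrum_iff {s : ℍ} {z : ℂ} (hre : z.re = s.re) (hnorm : ‖z‖ = ‖s‖)
    (T : X →L[ℍᵐᵒᵖ] X) :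
    s ∈ sSpectrum T ↔ z ∈ spectrum ℂ (toComplex T) ∨
      starRingEnd ℂ z ∈ spectrum ℂ (toComplex T) := by
  have hcomm : Commute (algebraMap ℂ (X →L[ℂ] X) z - toComplex T)
      (algebraMap ℂ (X →L[ℂ] X) (starRingEnd ℂ z) - toComplex T) :=
    Commute.sub_left (Algebra.commutes z _)
      (Commute.sub_right (Algebra.commutes (starRingEnd ℂ z) (toComplex T)).symm (Commute.refl _))
  change ¬ IsUnit (Q s T) ↔ ¬ IsUnit _ ∨ ¬ IsUnit _
  rw [← isUnit_toComplex_iff, toComplex_Q hre hnorm, hcomm.isUnit_mul_iff, not_and_or]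

/-- The peripheral `S`-spectrum lies in `{1}` exactly if the peripheral complex spectrum does. -/
lemma peripheralSSpectrum_subset_iff (T : X →L[ℍᵐᵒᵖ] X) :
    peripheralSSpectrum T ⊆ {1} ↔ ∀ z ∈ spectrum ℂ (toComplex T), ‖z‖ = 1 → z = 1 := by
  have hfr : frontier (Metric.ball (0 : ℍ) 1) = Metric.sphere 0 1 := frontier_ball _ one_ne_zero
  have hmem : ∀ s : ℍ, s ∈ peripheralSSpectrum T ↔ s ∈ sSpectrum T ∧ ‖s‖ = 1 := fun s => by
    rw [peripheralSSpectrum, hfr, Set.mem_inter_iff, mem_sphere_zero_iff_norm]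
  constructor
  · intro h z hz hz1
    have hs : (z : ℍ) ∈ peripheralSSpectrum T :=
      (hmem _).2 ⟨(mem_sSpectrum_iff rfl (norm_coeComplex z).symm T).2 (Or.inl hz),
        (norm_coeComplex z).trans hz1⟩
    have h1 : (z : ℍ) = 1 := h hs
    exact Complex.ext (congrArg (·.re) h1) (congrArg (·.imI) h1)
  · intro h s hs
    obtain ⟨hs, hs1⟩ := (hmem s).1 hs
    have hsq : s.re ^ 2 + s.imI ^ 2 + s.imJ ^ 2 + s.imK ^ 2 = 1 := by
      rw [← Quaternion.normSq_def', Quaternion.normSq_eq_norm_mul_self, hs1, one_mul]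
    -- a complex number in the conjugacy class of `s`
    obtain ⟨z, hre, hz1⟩ : ∃ z : ℂ, z.re = s.re ∧ ‖z‖ = 1 := by
      refine ⟨⟨s.re, √(1 - s.re ^ 2)⟩, rfl, ?_⟩
      have hnn : 0 ≤ 1 - s.re ^ 2 := by nlinarith
      rw [← sq_eq_sq₀ (norm_nonneg _) zero_le_one, Complex.sq_norm, Complex.normSq_mk,
        Real.mul_self_sqrt hnn]
      ring
    have hz : s.re = 1 := by
      rcases (mem_sSpectrum_iff hre (hz1.trans hs1.symm) T).1 hs with hz | hz
      · rw [← hre, h z hz hz1, Complex.one_re]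
      · rw [← hre, ← Complex.conj_re, h _ hz (by rwa [RCLike.norm_conj]), Complex.one_re]
    rw [hz] at hsq
    have hi : s.imI = 0 := by nlinarith
    have hj : s.imJ = 0 := by nlinarith
    have hk : s.imK = 0 := by nlinarith
    exact Quaternion.ext _ _ hz hi hj hk

end

end QuatOp

theorem theorem4p3 {X : Type*} [NormedAddCommGroup X] [CompleteSpace X]
    [Module ℍ X] [Module ℍᵐᵒᵖ X] [SMulCommClass ℍ ℍᵐᵒᵖ X]
    [NormSMulClass ℍ X] [NormSMulClass ℍᵐᵒᵖ X]
    (T : X →L[ℍᵐᵒᵖ] X) (hT : QuatOp.PowerBounded T) :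
    Filter.Tendsto (fun n : ℕ => QuatOp.opNorm (T ^ n - T ^ (n + 1))) Filter.atTop (nhds 0) ↔
      QuatOp.peripheralSSpectrum T ⊆ {1} := by
  let _ : NormedSpace ℂ X := QuatOp.complexNormedSpace X
  obtain ⟨M, hM⟩ := hT
  have hM' : ∀ n, ‖QuatOp.toComplex T ^ n‖ ≤ M := fun n => by
    rw [← map_pow, ← QuatOp.opNorm_eq_norm_toComplex]
    exact hM ⟨n, rfl⟩
  have hlim : Filter.Tendsto (fun n : ℕ => QuatOp.opNorm (T ^ n - T ^ (n + 1))) Filter.atTop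
      (nhds 0) ↔ Filter.Tendsto (fun n : ℕ => QuatOp.toComplex T ^ n - QuatOp.toComplex T ^ (n + 1))
        Filter.atTop (nhds 0) := by
    rw [tendsto_zero_iff_norm_tendsto_zero (E := X →L[ℂ] X)]
    simp only [QuatOp.opNorm_eq_norm_toComplex, map_sub, map_pow]
  rw [hlim, QuatOp.peripheralSSpectrum_subset_iff]
  exact ⟨fun h z hz hz1 => KatznelsonTzafriri.eq_one_of_mem_spectrum h hz hz1,
    fun h => KatznelsonTzafriri.tendsto_pow_sub_pow_succ hM' h⟩
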